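/- Let $\Omega_n=\{1<2<\dots<n\}$, $n\in\mathbb N$. A finite sequence $(a_1,\dots,a_t)$ in $\Omega_n$ is \emph{cyclic} if there is at most one index $i\in\{1,\dots,t\}$ with $a_i>a_{i+1}$, where $a_{t+1}=a_1$. An injective partial map $\alpha$ of $\Omega_n$ with domain $\{a_1<\dots<a_t\}$ ($t\ge 0$) is \emph{orientation-preserving} if $(a_1\alpha,\dots,a_t\alpha)$ is cyclic. For a nonempty subset $Y=\{y_1<\dots<y_r\}$ of $\Omega_n$, let $\mathcal{POPI}_n(Y)$ be the semigroup, under composition of partial maps (written on the right), of all injective orientation-preserving partial maps $\alpha$ of $\Omega_n$ with $\mathrm{Im}(\alpha)\subseteq Y$. Put $\mathrm{rank}(\alpha)=|\mathrm{Im}(\alpha)|$ for such an $\alpha$; the rank of a finite semigroup $S$ is the least cardinality of a subset $A\subseteq S$ that generates $S$ as a semigroup. Elements $a,b\in S$ are $\mathscr R$-related if $aS^1=bS^1$, where $aS^1=\{a\}\cup aS$. \textbf{Theorem.} Let $Y$ be a nonempty subset of $\Omega_n$ with $|Y|=r$. Then $$\mathrm{rank}(\mathcal{POPI}_n(Y))=\begin{cases}\binom{n}{r}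 & \text{if } 1\le r\le n-1,\\ 2 & \text{if } r=n.\end{cases}$$ Moreover, if $Y\neq\Omega_n$, then $\mathcal{POPI}_n(Y)$ is generated by its elements of rank $r$; and, if $\bar g$ denotes the permutation $y_1\mapsto y_2\mapsto\cdots\mapsto y_r\mapsto y_1$ of $Y$, regarded as an element of $\mathcal{POPI}_n(Y)$ with domain and image $Y$, then every subset of $\mathcal{POPI}_n(Y)$ that contains $\bar g$ and at least one element from each $\mathscr R$-class of elements of rank $r$ generates $\mathcal{POPI}_n(Y)$. -/

import Mathlib

/-! ### Semigroup notions -/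

/-- The rank of a finite semigroup `S`: the least cardinality of a subset `A` of `S` that
generates `S` as a semigroup. -/
noncomputable def semigroupRank (S : Type*) [Semigroup S] : ℕ :=
  sInf {k : ℕ | ∃ A : Finset S, A.card = k ∧ Subsemigroup.closure (A : Set S) = ⊤}

/-- The principal right ideal `a S¹ = {a} ∪ a S`. -/
def principalRightIdeal {S : Type*} [Semigroup S] (a : S) : Set S :=
  {x | x = a ∨ ∃ s : S, x = a * s}

/-- Green's relation `R`: `a S¹ = b S¹`. -/
def GreenR {S : Type*} [Semigroup S] (a b : S) : Prop :=
  principalRightIdeal a = principalRightIdeal b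

/-! ### Partial permutations of a chain with `n` elements -/

/-- The partial permutations of the chain `Fin n`. -/
abbrev PartialPerm (n : ℕ) : Type := Fin n ≃. Fin n

/-- The symmetric inverse monoid. Maps act on the right: `α * β` is "first `α`, then `β`". -/
instance PartialPerm.instMonoid (n : ℕ) : Monoid (PartialPerm n) where
  mul α β := α.trans β
  one := PEquiv.refl (Fin n)
  mul_assoc := PEquiv.trans_assoc
  one_mul := PEquiv.refl_trans
  mul_one := PEquiv.trans_refl

namespace PartialPerm

variable {n : ℕ}

/-- The domain of a partial permutation. -/
def dom (α : PartialPerm n) : Finset (Fin n) :=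
  Finset.univ.filter fun x => (α x).isSome

/-- The image of a partial permutation. -/
def im (α : PartialPerm n) : Finset (Fin n) :=
  Finset.univ.filter fun y => ∃ x, α x = some y

/-- The rank of a partial permutation: the size of its image. -/
def rank (α : PartialPerm n) : ℕ := α.im.card

/-- If the domain is `{a₁ < ⋯ < aₜ}`, this is the sequence `(a₁ α, …, aₜ α)`. -/
def imageSeq (α : PartialPerm n) : Fin α.dom.card → Fin n := fun i =>
  (α (α.dom.orderEmbOfFin rfl i)).get
    (Finset.mem_filter.1 (α.dom.orderEmbOfFin_mem rfl i)).2

end PartialPerm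

/-- A sequence `(a₁, …, aₜ)` is cyclic if there is at most one index `i` with `aᵢ > aᵢ₊₁`, where
`aₜ₊₁` denotes `a₁` (`finRotate t` sends `i` to `i + 1` and the last index to the first one). -/
def IsCyclicSeq {n t : ℕ} (s : Fin t → Fin n) : Prop :=
  ∀ i j : Fin t, s (finRotate t i) < s i → s (finRotate t j) < s j → i = j

/-- A partial permutation is orientation-preserving if the sequence of the images of the elements
of its domain, listed in increasing order, is cyclic. -/
def PartialPerm.OrientationPreserving {n : ℕ} (α : PartialPerm n) : Prop :=
  IsCyclicSeq α.imageSeq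

/-! ### Helper facts: orientation-preserving partial permutations are closed under products -/

/-- `a`, `b`, `c` are distinct and occur in this cyclic order. -/
def CycOrd {n : ℕ} (a b c : Fin n) : Prop :=
  (a < b ∧ b < c) ∨ (b < c ∧ c < a) ∨ (c < a ∧ a < b)

theorem exists_descent (f : ℕ → ℕ) {a b : ℕ} (hab : a ≤ b) (h : f b < f a) :
    ∃ p, a ≤ p ∧ p < b ∧ f (p + 1) < f p := by
  by_contra hc
  push Not at hc
  have key : ∀ d, a + d ≤ b → f a ≤ f (a + d) := by
    intro d
    induction d with
    | zero => simp
    | succ d ih =>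
      intro hd
      exact (ih (by omega)).trans (hc (a + d) (by omega) (by omega))
  have := key (b - a) (by omega)
  rw [Nat.add_sub_cancel' hab] at this
  omega

theorem val_finRotate {m : ℕ} (i : Fin (m + 1)) :
    ((finRotate (m + 1) i : Fin (m + 1)) : ℕ) = (i.1 + 1) % (m + 1) := by
  rw [finRotate_apply, Fin.val_add, Fin.val_one', Nat.add_mod_mod]

theorem isCyclicSeq_iff {n t : ℕ} (s : Fin t → Fin n) (hs : Function.Injective s) :
    IsCyclicSeq s ↔ ∀ i j k : Fin t, i < j → j < k → CycOrd (s i) (s j) (s k) := by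
  obtain _ | m := t
  · exact ⟨fun _ i => i.elim0, fun _ i => i.elim0⟩
  constructor
  · intro h i j k hij hjk
    let f : ℕ → ℕ := fun p => (s ⟨p % (m + 1), Nat.mod_lt _ (Nat.succ_pos m)⟩).1
    have hf : ∀ x : Fin (m + 1), f x.1 = (s x).1 := fun x => by
      simp only [f]; congr 2; exact Fin.ext (Nat.mod_eq_of_lt x.2)
    have hf' : f (i.1 + (m + 1)) = (s i).1 := by
      rw [← hf i]; simp only [f, Nat.add_mod_right]
    have hu : ∀ p q, f (p + 1) < f p → f (q + 1) < f q → p < q → q < p + (m + 1) → False := by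
      intro p q hp hq h1 h2
      have e : ∀ p, finRotate (m + 1) ⟨p % (m + 1), Nat.mod_lt _ (Nat.succ_pos m)⟩
          = ⟨(p + 1) % (m + 1), Nat.mod_lt _ (Nat.succ_pos m)⟩ := fun p => by
        apply Fin.ext; rw [val_finRotate]; simp
      have := h ⟨p % (m + 1), Nat.mod_lt _ (Nat.succ_pos m)⟩
        ⟨q % (m + 1), Nat.mod_lt _ (Nat.succ_pos m)⟩ (by rw [e]; exact hp) (by rw [e]; exact hq)
      have h3 : p ≡ q [MOD (m + 1)] := congrArg Fin.val this
      have h4 := (Nat.modEq_iff_dvd' h1.le).1 h3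
      have := Nat.le_of_dvd (by omega) h4
      omega
    have n1 : (s i).1 ≠ (s j).1 := fun e => hij.ne (hs (Fin.ext e))
    have n2 : (s j).1 ≠ (s k).1 := fun e => hjk.ne (hs (Fin.ext e))
    have n3 : (s i).1 ≠ (s k).1 := fun e => (hij.trans hjk).ne (hs (Fin.ext e))
    have hij' : i.1 < j.1 := hij
    have hjk' : j.1 < k.1 := hjk
    have hk := k.2
    have d1 : (s j).1 < (s i).1 → ∃ p, i.1 ≤ p ∧ p < j.1 ∧ f (p + 1) < f p := fun h =>
      exists_descent f hij'.le (by rw [hf, hf]; exact h)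
    have d2 : (s k).1 < (s j).1 → ∃ p, j.1 ≤ p ∧ p < k.1 ∧ f (p + 1) < f p := fun h =>
      exists_descent f hjk'.le (by rw [hf, hf]; exact h)
    have d3 : (s i).1 < (s k).1 → ∃ p, k.1 ≤ p ∧ p < i.1 + (m + 1) ∧ f (p + 1) < f p := fun h =>
      exists_descent f (by omega) (by rw [hf', hf]; exact h)
    by_contra hc
    simp only [CycOrd, Fin.lt_def] at hc
    have : ((s j).1 < (s i).1 ∧ (s k).1 < (s j).1) ∨ ((s j).1 < (s i).1 ∧ (s i).1 < (s k).1) ∨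
        ((s k).1 < (s j).1 ∧ (s i).1 < (s k).1) := by
      clear d1 d2 d3 hu hf hf'
      omega
    rcases this with ⟨h1, h2⟩ | ⟨h1, h2⟩ | ⟨h1, h2⟩
    · obtain ⟨p, _, _, hp⟩ := d1 h1
      obtain ⟨q, _, _, hq⟩ := d2 h2
      exact hu p q hp hq (by omega) (by omega)
    · obtain ⟨p, _, _, hp⟩ := d1 h1
      obtain ⟨q, _, _, hq⟩ := d3 h2
      exact hu p q hp hq (by omega) (by omega)
    · obtain ⟨p, _, _, hp⟩ := d2 h1
      obtain ⟨q, _, _, hq⟩ := d3 h2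
      exact hu p q hp hq (by omega) (by omega)
  · intro h
    have key : ∀ p q : Fin (m + 1), s (finRotate _ p) < s p → s (finRotate _ q) < s q →
        p < q → False := by
      intro p q hp hq hpq
      obtain ⟨p', hp'⟩ : ∃ p', p' = finRotate (m + 1) p := ⟨_, rfl⟩
      obtain ⟨q', hq'⟩ : ∃ q', q' = finRotate (m + 1) q := ⟨_, rfl⟩
      have vp : p'.1 = p.1 + 1 := by
        rw [hp', val_finRotate, Nat.mod_eq_of_lt]
        have : p.1 < q.1 := hpq
        omega
      have vq : (q'.1 = q.1 + 1) ∨ (q'.1 = 0 ∧ q.1 = m) := by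
        rw [hq', val_finRotate]
        by_cases hm : q.1 = m
        · right; simp [hm]
        · left; rw [Nat.mod_eq_of_lt]; omega
      rw [← hp'] at hp
      rw [← hq'] at hq
      have T : ∀ i j k : Fin (m + 1), i.1 < j.1 → j.1 < k.1 →
          ((s i).1 < (s j).1 ∧ (s j).1 < (s k).1) ∨ ((s j).1 < (s k).1 ∧ (s k).1 < (s i).1) ∨
            ((s k).1 < (s i).1 ∧ (s i).1 < (s j).1) := fun i j k h1 h2 => h i j k h1 h2
      rw [Fin.lt_def] at hp hq hpq
      have eqs : ∀ x y : Fin (m + 1), x.1 = y.1 → (s x).1 = (s y).1 := fun x y e => by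
        rw [Fin.ext e]
      have t1 := T p p' q
      have t2 := T p p' q'
      have t3 := T p' q q'
      have t4 := T p q q'
      have t5 := T q' p q
      have t6 := T q' p p'
      have t7 := T q' p' q
      have e1 := eqs p' q
      have e2 := eqs p q'
      omega
    intro i j hi hj
    rcases lt_trichotomy i j with hij | hij | hij
    · exact (key i j hi hj hij).elim
    · exact hij
    · exact (key j i hj hi hij).elim

theorem CycOrd.of_triples {n : ℕ} {α : PartialPerm n}
    (h : ∀ a b c a' b' c' : Fin n, α a = some a' → α b = some b' → α c = some c' →
      a < b → b < c → CycOrd a' b' c')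
    {a b c a' b' c' : Fin n} (ha : α a = some a') (hb : α b = some b') (hc : α c = some c')
    (habc : CycOrd a b c) : CycOrd a' b' c' := by
  rcases habc with ⟨h1, h2⟩ | ⟨h1, h2⟩ | ⟨h1, h2⟩
  · exact h _ _ _ _ _ _ ha hb hc h1 h2
  · have := h _ _ _ _ _ _ hb hc ha h1 h2
    simp only [CycOrd] at this ⊢; tauto
  · have := h _ _ _ _ _ _ hc ha hb h1 h2
    simp only [CycOrd] at this ⊢; tauto

namespace PartialPerm

variable {n : ℕ}

theorem apply_orderEmb (α : PartialPerm n) (i : Fin α.dom.card) :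
    α (α.dom.orderEmbOfFin rfl i) = some (α.imageSeq i) := by
  simp [imageSeq]

theorem imageSeq_injective (α : PartialPerm n) : Function.Injective α.imageSeq := by
  intro i j hij
  have h1 := α.apply_orderEmb i
  have h2 := α.apply_orderEmb j
  rw [hij] at h1
  exact (α.dom.orderEmbOfFin rfl).injective (α.inj h1 h2)

theorem exists_index (α : PartialPerm n) {a a' : Fin n} (h : α a = some a') :
    ∃ i, α.dom.orderEmbOfFin rfl i = a ∧ α.imageSeq i = a' := by
  have : a ∈ Set.range (α.dom.orderEmbOfFin rfl) := by
    rw [Finset.range_orderEmbOfFin]; simp [dom, h]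
  obtain ⟨i, rfl⟩ := this
  exact ⟨i, rfl, by simpa [h] using (α.apply_orderEmb i).symm⟩

/-- For partial permutations, orientation-preserving means that the cyclic order of triples is
preserved. -/
theorem orientationPreserving_iff (α : PartialPerm n) :
    α.OrientationPreserving ↔
      ∀ a b c a' b' c' : Fin n, α a = some a' → α b = some b' → α c = some c' →
        a < b → b < c → CycOrd a' b' c' := by
  rw [OrientationPreserving, isCyclicSeq_iff _ α.imageSeq_injective]
  constructor
  · intro h a b c a' b' c' ha hb hc hab hbc
    obtain ⟨i, rfl, rfl⟩ := α.exists_index ha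
    obtain ⟨j, rfl, rfl⟩ := α.exists_index hb
    obtain ⟨k, rfl, rfl⟩ := α.exists_index hc
    exact h i j k ((OrderEmbedding.lt_iff_lt _).1 hab) ((OrderEmbedding.lt_iff_lt _).1 hbc)
  · intro h i j k hij hjk
    exact h _ _ _ _ _ _ (α.apply_orderEmb i) (α.apply_orderEmb j) (α.apply_orderEmb k)
      ((OrderEmbedding.lt_iff_lt _).2 hij) ((OrderEmbedding.lt_iff_lt _).2 hjk)

theorem mul_eq_some (α β : PartialPerm n) (a c : Fin n) :
    (α * β) a = some c ↔ ∃ b, α a = some b ∧ β b = some c :=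
  PEquiv.trans_eq_some α β a c

theorem OrientationPreserving.mul {α β : PartialPerm n} (hα : α.OrientationPreserving)
    (hβ : β.OrientationPreserving) : (α * β).OrientationPreserving := by
  rw [orientationPreserving_iff] at *
  intro a b c a' b' c' ha hb hc hab hbc
  obtain ⟨a₁, ha₁, ha₂⟩ := (mul_eq_some _ _ _ _).1 ha
  obtain ⟨b₁, hb₁, hb₂⟩ := (mul_eq_some _ _ _ _).1 hb
  obtain ⟨c₁, hc₁, hc₂⟩ := (mul_eq_some _ _ _ _).1 hc
  exact CycOrd.of_triples hβ ha₂ hb₂ hc₂ (hα _ _ _ _ _ _ ha₁ hb₁ hc₁ hab hbc)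

theorem mem_im (α : PartialPerm n) (y : Fin n) : y ∈ α.im ↔ ∃ x, α x = some y := by
  simp [im]

end PartialPerm

/-! ### The semigroups `POPI_n` and `POPI_n(Y)` -/

/-- The monoid of all orientation-preserving partial permutations of `Fin n`. -/
def POPI (n : ℕ) : Submonoid (PartialPerm n) where
  carrier := {α | α.OrientationPreserving}
  mul_mem' hα hβ := hα.mul hβ
  one_mem' := by
    refine (PartialPerm.orientationPreserving_iff _).2 ?_
    intro a b c a' b' c' ha hb hc hab hbc
    cases ha; cases hb; cases hc
    exact Or.inl ⟨hab, hbc⟩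

/-- The semigroup of all orientation-preserving partial permutations with image contained
in `Y`. -/
def POPIRange {n : ℕ} (Y : Finset (Fin n)) : Subsemigroup (PartialPerm n) where
  carrier := {α | α ∈ POPI n ∧ α.im ⊆ Y}
  mul_mem' := by
    rintro α β ⟨hα, _⟩ ⟨hβ, hY⟩
    refine ⟨mul_mem hα hβ, fun y hy => hY ?_⟩
    obtain ⟨x, hx⟩ := (PartialPerm.mem_im _ _).1 hy
    obtain ⟨z, _, hz⟩ := (PartialPerm.mul_eq_some _ _ _ _).1 hx
    exact (PartialPerm.mem_im _ _).2 ⟨z, hz⟩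

/-- The permutation `y₁ ↦ y₂ ↦ ⋯ ↦ yᵣ ↦ y₁` of `Y = {y₁ < ⋯ < yᵣ}`. -/
def cyclicShiftPerm {n : ℕ} (Y : Finset (Fin n)) : Equiv.Perm Y :=
  (Y.orderIsoOfFin rfl).toEquiv.permCongr (finRotate Y.card)

/-- The cyclic shift of `Y = {y₁ < ⋯ < yᵣ}`, as a partial permutation with domain and
image `Y`. -/
def cyclicShiftFun {n : ℕ} (Y : Finset (Fin n)) : PartialPerm n where
  toFun x := if h : x ∈ Y then some (cyclicShiftPerm Y ⟨x, h⟩ : Fin n) else none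
  invFun y := if h : y ∈ Y then some ((cyclicShiftPerm Y).symm ⟨y, h⟩ : Fin n) else none
  inv x y := by
    constructor
    · intro h
      by_cases hy : y ∈ Y
      · simp only [hy, dite_true, Option.some.injEq] at h
        subst h
        simp
      · simp [hy] at h
    · intro h
      by_cases hx : x ∈ Y
      · simp only [hx, dite_true, Option.some.injEq] at h
        subst h
        simp
      · simp [hx] at h

theorem cyclicShiftFun_apply {n : ℕ} (Y : Finset (Fin n)) (x : Fin n) :
    cyclicShiftFun Y x = if h : x ∈ Y then some (cyclicShiftPerm Y ⟨x, h⟩ : Fin n) else none :=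
  rfl

theorem finRotate_cycOrd {t : ℕ} (i j k : Fin t) (hij : i < j) (hjk : j < k) :
    CycOrd (finRotate t i) (finRotate t j) (finRotate t k) := by
  obtain _ | m := t
  · exact i.elim0
  have hk := k.2
  simp only [CycOrd, Fin.lt_def, val_finRotate] at *
  rw [Nat.mod_eq_of_lt (a := i.1 + 1) (by omega), Nat.mod_eq_of_lt (a := j.1 + 1) (by omega)]
  by_cases h : k.1 = m
  · have h0 : (k.1 + 1) % (m + 1) = 0 := by rw [h, Nat.mod_self]
    rw [h0]; omega
  · rw [Nat.mod_eq_of_lt (a := k.1 + 1) (by omega)]; omega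

theorem cyclicShiftFun_mem {n : ℕ} (Y : Finset (Fin n)) : cyclicShiftFun Y ∈ POPIRange Y := by
  have hval : ∀ {x x' : Fin n}, cyclicShiftFun Y x = some x' →
      ∃ i, Y.orderEmbOfFin rfl i = x ∧ Y.orderEmbOfFin rfl (finRotate _ i) = x' := by
    intro x x' h
    rw [cyclicShiftFun_apply] at h
    by_cases hx : x ∈ Y
    · simp only [hx, dite_true, Option.some.injEq] at h
      refine ⟨(Y.orderIsoOfFin rfl).symm ⟨x, hx⟩, ?_, ?_⟩
      · rw [← Finset.coe_orderIsoOfFin_apply, OrderIso.apply_symm_apply]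
      · rw [← h, ← Finset.coe_orderIsoOfFin_apply]; rfl
    · simp [hx] at h
  refine ⟨(PartialPerm.orientationPreserving_iff _).2 ?_, ?_⟩
  · intro a b c a' b' c' ha hb hc hab hbc
    obtain ⟨i, rfl, rfl⟩ := hval ha
    obtain ⟨j, rfl, rfl⟩ := hval hb
    obtain ⟨k, rfl, rfl⟩ := hval hc
    have := finRotate_cycOrd i j k ((OrderEmbedding.lt_iff_lt _).1 hab)
      ((OrderEmbedding.lt_iff_lt _).1 hbc)
    simpa only [CycOrd, OrderEmbedding.lt_iff_lt] using this
  · intro y hy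
    obtain ⟨x, hx⟩ := (PartialPerm.mem_im _ _).1 hy
    obtain ⟨i, _, rfl⟩ := hval hx
    exact Finset.orderEmbOfFin_mem _ _ _

/-- The cyclic shift of `Y` as an element of `POPI_n(Y)`. -/
def cyclicShift {n : ℕ} (Y : Finset (Fin n)) : POPIRange Y :=
  ⟨cyclicShiftFun Y, cyclicShiftFun_mem Y⟩

/-!
The proof works with sequences instead of domains and images. A sequence `c : Fin k ↪ Fin n` is
called cyclic here if it preserves the ternary cyclic order (`CycHom`), and an
orientation-preserving map of rank `k` is the same thing as a correspondence `c i ↦ d i` between two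
cyclic sequences of length `k` (`ofSeq`). Two cyclic sequences with the same range differ by a
rotation of the index set (`CycHom.eq_comp_finRotate_pow`). Hence two elements of rank `r = |Y|` with
the same domain differ by right multiplication by a power of the cyclic shift of `Y`
(`exists_eq_mul_cyclicShiftFun_pow`).

The heart of the matter is that a map `α` in `POPI_n(Y)` of rank `k` with `k < r` and `k + 2 ≤ n` is
a product of two maps in `POPI_n(Y)` of rank `k + 1` (`exists_mul_of_rank_lt`). Pick `x` outside the
domain and `z` in `Y` outside the image of `α`. In general `α` does not extend by `x ↦ z`, because
`x` and `z` lie in different gaps. So `α` is routed through `k` points of a set of `k + 2` points, of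
which one of the two spare points lies in the gap of `x` and the other in the gap of `z`: the first
factor extends to `x`, the second one has `z` as an additional value, and the two extensions use
different spare points. The spare point used by the second factor belongs to its domain only, so
it need not lie in `Y`, and a set of `k + 1 ≤ r` points of `Y` together with one point of the chain
suffices.

If `r < n`, it follows by induction that the elements of rank `r` generate, and thus so do the cyclic
shift and one element for each domain of size `r`. There are `n.choose r` domains, and each of them
must be the domain of a generator, since the domain of a product is contained in that of its first
factor. If `r = n`, it follows that the elements of rank at least `n - 1` generate; up to
multiplication by rotations on both sides, those of rank `n - 1` are powers of the cyclic shift of the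
chain with one point removed (`POPIRange_univ_le`). One generator is not enough, since there must be
one with full domain and one without.
-/

/-! ### Maps preserving the cyclic order -/

theorem CycOrd.not_swap {n : ℕ} {a b c : Fin n} (h : CycOrd a b c) : ¬ CycOrd b a c := by
  simp only [CycOrd, Fin.lt_def] at *; omega

theorem CycOrd.or_swap {n : ℕ} {a b c : Fin n} (hab : a ≠ b) (hbc : b ≠ c) (hac : a ≠ c) :
    CycOrd a b c ∨ CycOrd b a c := by
  simp only [CycOrd, Fin.lt_def, ne_eq, Fin.ext_iff] at *; omega

/-- A map preserving the ternary cyclic order. -/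
def CycHom {m n : ℕ} (f : Fin m → Fin n) : Prop :=
  ∀ i j k, CycOrd i j k → CycOrd (f i) (f j) (f k)

theorem cycHom_of_lt {m n : ℕ} {f : Fin m → Fin n}
    (h : ∀ i j k, i < j → j < k → CycOrd (f i) (f j) (f k)) : CycHom f := by
  rintro i j k (⟨h1, h2⟩ | ⟨h1, h2⟩ | ⟨h1, h2⟩)
  · exact h _ _ _ h1 h2
  · have := h _ _ _ h1 h2
    simp only [CycOrd] at this ⊢; tauto
  · have := h _ _ _ h1 h2
    simp only [CycOrd] at this ⊢; tauto

theorem StrictMono.cycHom {m n : ℕ} {f : Fin m → Fin n} (h : StrictMono f) : CycHom f :=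
  cycHom_of_lt fun _ _ _ h1 h2 => Or.inl ⟨h h1, h h2⟩

theorem CycHom.comp {l m n : ℕ} {g : Fin m → Fin n} {f : Fin l → Fin m} (hg : CycHom g)
    (hf : CycHom f) : CycHom (g ∘ f) := fun _ _ _ h => hg _ _ _ (hf _ _ _ h)

theorem CycHom.trans {l m n : ℕ} {f : Fin l ↪ Fin m} {g : Fin m ↪ Fin n} (hf : CycHom f)
    (hg : CycHom g) : CycHom (f.trans g) := hg.comp hf

/-- Since any three distinct points are in one of the two cyclic orders, a map preserving the cyclic
order also reflects it. -/
theorem CycHom.reflect {m n : ℕ} {f : Fin m → Fin n} (hf : CycHom f) {i j k : Fin m}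
    (h : CycOrd (f i) (f j) (f k)) : CycOrd i j k := by
  have irrefl : i ≠ j ∧ j ≠ k ∧ i ≠ k := by
    refine ⟨?_, ?_, ?_⟩ <;> rintro rfl <;> simp only [CycOrd, Fin.lt_def] at h <;> omega
  rcases CycOrd.or_swap irrefl.1 irrefl.2.1 irrefl.2.2 with h' | h'
  · exact h'
  · exact (h.not_swap (hf _ _ _ h')).elim

theorem cycHom_finRotate_pow (m s : ℕ) : CycHom (finRotate m ^ s : Equiv.Perm (Fin m)) := by
  induction s with
  | zero => exact fun _ _ _ h => h
  | succ s ih =>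
    rw [pow_succ, Equiv.Perm.coe_mul]
    exact ih.comp (cycHom_of_lt finRotate_cycOrd)

theorem val_finRotate_pow {m : ℕ} (s : ℕ) (i : Fin m) :
    (((finRotate m ^ s : Equiv.Perm (Fin m)) i : Fin m) : ℕ) = (i.1 + s) % m := by
  obtain _ | m := m
  · exact i.elim0
  induction s with
  | zero => simp [Nat.mod_eq_of_lt i.2]
  | succ s ih =>
    rw [pow_succ', Equiv.Perm.mul_apply, val_finRotate, ih, Nat.mod_add_mod, Nat.add_assoc]

theorem exists_finRotate_pow_eq {m : ℕ} (i j : Fin m) :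
    ∃ s, (finRotate m ^ (s + 1) : Equiv.Perm (Fin m)) i = j := by
  refine ⟨j.1 + 2 * m - i.1 - 1, Fin.ext ?_⟩
  rw [val_finRotate_pow]
  have e : i.1 + (j.1 + 2 * m - i.1 - 1 + 1) = j.1 + m * 2 := by omega
  rw [e, Nat.add_mul_mod_self_left, Nat.mod_eq_of_lt j.2]

/-- Cyclic enumerations of the same set differ by a rotation. -/
theorem CycHom.eq_comp_finRotate_pow {k n : ℕ} {c c' : Fin k ↪ Fin n} (hc : CycHom c)
    (hc' : CycHom c') (h : ∀ i, c' i ∈ Set.range c) :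
    ∃ s, ∀ i, c' i = c ((finRotate k ^ (s + 1) : Equiv.Perm (Fin k)) i) := by
  obtain _ | m := k
  · exact ⟨0, fun i => i.elim0⟩
  obtain ⟨j, hj⟩ := h 0
  obtain ⟨s, hs⟩ := exists_finRotate_pow_eq 0 j
  refine ⟨s, ?_⟩
  set ρ := (finRotate (m + 1) ^ (s + 1) : Equiv.Perm (Fin (m + 1))) with hρ
  have hcρ : CycHom (c ∘ ρ) := hc.comp (cycHom_finRotate_pow _ _)
  have : ∀ i, ∃ p, c (ρ p) = c' i := fun i => by
    obtain ⟨q, hq⟩ := h i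
    exact ⟨ρ.symm q, by simpa using hq⟩
  choose π hπ using this
  have hinj : Function.Injective π := fun a b hab => c'.injective (by rw [← hπ, ← hπ, hab])
  have hπ0 : π 0 = 0 := by
    apply ρ.injective; apply c.injective; rw [hπ, hs, hj]
  have hπc : CycHom π := fun a b d habd => hcρ.reflect (by
    simpa only [Function.comp, hπ] using hc' _ _ _ habd)
  -- a map that preserves the cyclic order and fixes the least element is increasing
  have hmono : StrictMono π := by
    intro a b hab
    by_cases ha : a = 0
    · rw [ha, hπ0]
      refine Fin.pos_iff_ne_zero.2 fun hb => ?_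
      have := hinj (hb.trans hπ0.symm)
      omega
    · have h3 := hπc 0 a b (Or.inl ⟨Fin.pos_iff_ne_zero.2 ha, hab⟩)
      rw [hπ0] at h3
      simp only [CycOrd, Fin.lt_def, Fin.val_zero] at h3
      rw [Fin.lt_def]; omega
  have hid : π = id :=
    (hmono.range_inj strictMono_id).1 (by
      rw [(Finite.injective_iff_surjective.1 hinj).range_eq, Set.range_id])
  intro i
  rw [← hπ i, hid, id]

theorem exists_cycHom_enum {n k : ℕ} (X : Finset (Fin n)) (hX : X.card = k) :
    ∃ c : Fin k ↪ Fin n, CycHom c ∧ ∀ x, x ∈ X ↔ ∃ i, c i = x := by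
  refine ⟨(X.orderEmbOfFin hX).toEmbedding, (X.orderEmbOfFin hX).strictMono.cycHom, fun x => ?_⟩
  have := Set.ext_iff.1 (Finset.range_orderEmbOfFin X hX) x
  exact this.symm

theorem exists_cycHom_enum_at {n k : ℕ} (X : Finset (Fin n)) (hX : X.card = k) (p : Fin k)
    {x : Fin n} (hx : x ∈ X) :
    ∃ c : Fin k ↪ Fin n, CycHom c ∧ (∀ x, x ∈ X ↔ ∃ i, c i = x) ∧ c p = x := by
  obtain ⟨c, hc, hcX⟩ := exists_cycHom_enum X hX
  obtain ⟨q, hq⟩ := (hcX x).1 hx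
  obtain ⟨s, hs⟩ := exists_finRotate_pow_eq p q
  set ρ := (finRotate k ^ (s + 1) : Equiv.Perm (Fin k))
  refine ⟨ρ.toEmbedding.trans c, hc.comp (cycHom_finRotate_pow _ _), fun y => ?_, ?_⟩
  · rw [hcX]
    exact ⟨fun ⟨i, hi⟩ => ⟨ρ.symm i, by simpa using hi⟩, fun ⟨i, hi⟩ => ⟨ρ i, hi⟩⟩
  · simpa [hs] using hq

/-! ### Partial permutations given by pairs of sequences -/

namespace PartialPerm

variable {n : ℕ}

open Classical in
/-- The partial permutation `c i ↦ d i`, defined on the range of `c`. -/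
noncomputable def ofSeq {k : ℕ} (c d : Fin k ↪ Fin n) : PartialPerm n where
  toFun x := if h : ∃ i, c i = x then some (d h.choose) else none
  invFun y := if h : ∃ i, d i = y then some (c h.choose) else none
  inv x y := by
    have key : ∀ (c d : Fin k ↪ Fin n) (x y : Fin n),
        y ∈ (if h : ∃ i, c i = x then some (d h.choose) else none) ↔ ∃ i, c i = x ∧ d i = y := by
      intro c d x y
      by_cases h : ∃ i, c i = x
      · simp only [h, dite_true, Option.mem_def, Option.some.injEq]
        refine ⟨fun h' => ⟨_, h.choose_spec, h'⟩, ?_⟩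
        rintro ⟨i, hi, rfl⟩
        rw [c.injective (h.choose_spec.trans hi.symm)]
      · simp only [h, dite_false, Option.mem_def, reduceCtorEq, false_iff]
        exact fun ⟨i, hi, _⟩ => h ⟨i, hi⟩
    exact (key d c y x).trans ((exists_congr fun _ => and_comm).trans (key c d x y).symm)

theorem ofSeq_eq_some {k : ℕ} (c d : Fin k ↪ Fin n) (x y : Fin n) :
    ofSeq c d x = some y ↔ ∃ i, c i = x ∧ d i = y := by
  change (if h : ∃ i, c i = x then some (d h.choose) else none) = some y ↔ _
  by_cases h : ∃ i, c i = x
  · simp only [h, dite_true, Option.some.injEq]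
    refine ⟨fun h' => ⟨_, h.choose_spec, h'⟩, ?_⟩
    rintro ⟨i, hi, rfl⟩
    rw [c.injective (h.choose_spec.trans hi.symm)]
  · simp only [h, dite_false, reduceCtorEq, false_iff]
    exact fun ⟨i, hi, _⟩ => h ⟨i, hi⟩

theorem mem_dom (α : PartialPerm n) (x : Fin n) : x ∈ α.dom ↔ ∃ y, α x = some y := by
  simp [dom, Option.isSome_iff_exists]

theorem ext_some {α β : PartialPerm n} (h : ∀ x y, α x = some y ↔ β x = some y) : α = β :=
  PEquiv.ext fun x => Option.ext fun y => h x y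

theorem mem_dom_ofSeq {k : ℕ} (c d : Fin k ↪ Fin n) (x : Fin n) :
    x ∈ (ofSeq c d).dom ↔ ∃ i, c i = x := by
  simp [mem_dom, ofSeq_eq_some]

theorem mem_im_ofSeq {k : ℕ} (c d : Fin k ↪ Fin n) (y : Fin n) :
    y ∈ (ofSeq c d).im ↔ ∃ i, d i = y := by
  simp [mem_im, ofSeq_eq_some]

theorem rank_ofSeq {k : ℕ} (c d : Fin k ↪ Fin n) : (ofSeq c d).rank = k := by
  have : (ofSeq c d).im = Finset.univ.map d := by
    ext y; simp [mem_im_ofSeq]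
  rw [rank, this, Finset.card_map, Finset.card_univ, Fintype.card_fin]

theorem orientationPreserving_ofSeq {k : ℕ} {c d : Fin k ↪ Fin n} (hc : CycHom c)
    (hd : CycHom d) : (ofSeq c d).OrientationPreserving := by
  rw [orientationPreserving_iff]
  simp only [ofSeq_eq_some]
  rintro _ _ _ _ _ _ ⟨i, rfl, rfl⟩ ⟨j, rfl, rfl⟩ ⟨l, rfl, rfl⟩ h1 h2
  exact hd _ _ _ (hc.reflect (Or.inl ⟨h1, h2⟩))

/-- An orientation-preserving map turns any cyclic enumeration of its domain into a cyclic
enumeration of its image. -/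
theorem OrientationPreserving.exists_eq_ofSeq {α : PartialPerm n} (hα : α.OrientationPreserving)
    {k : ℕ} {c : Fin k ↪ Fin n} (hc : CycHom c) (h : ∀ x, x ∈ α.dom ↔ ∃ i, c i = x) :
    ∃ d : Fin k ↪ Fin n, CycHom d ∧ α = ofSeq c d := by
  have : ∀ i, ∃ y, α (c i) = some y := fun i => (mem_dom _ _).1 ((h _).2 ⟨i, rfl⟩)
  choose d hd using this
  refine ⟨⟨d, fun i j hij => c.injective (α.inj (hd i) (by rw [hij]; exact hd j))⟩, ?_, ?_⟩
  · intro i j l hijl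
    exact CycOrd.of_triples ((orientationPreserving_iff α).1 hα) (hd i) (hd j) (hd l)
      (hc _ _ _ hijl)
  · refine ext_some fun x y => ?_
    rw [ofSeq_eq_some]
    constructor
    · intro hxy
      obtain ⟨i, rfl⟩ := (h x).1 ((mem_dom _ _).2 ⟨y, hxy⟩)
      exact ⟨i, rfl, Option.some_injective _ ((hd i).symm.trans hxy)⟩
    · rintro ⟨i, rfl, rfl⟩
      exact hd i

theorem card_dom (α : PartialPerm n) : α.dom.card = α.rank := by
  refine Finset.card_bij (fun x hx => ((mem_dom α x).1 hx).choose) (fun x hx => ?_)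
    (fun x hx x' hx' e => ?_) (fun y hy => ?_)
  · exact (mem_im _ _).2 ⟨x, ((mem_dom α x).1 hx).choose_spec⟩
  · refine α.inj ((mem_dom α x).1 hx).choose_spec ?_
    rw [Option.mem_def, e]
    exact ((mem_dom α x').1 hx').choose_spec
  · obtain ⟨x, hx⟩ := (mem_im _ _).1 hy
    have hx' := (mem_dom α x).2 ⟨y, hx⟩
    exact ⟨x, hx', Option.some_injective _ (((mem_dom α x).1 hx').choose_spec.symm.trans hx)⟩

end PartialPerm

/-! ### Factorization into maps of larger rank -/

/-- Let `q = k - s % k`. Inserting `k` points in a circle of `k + 1` places so that place `q` is free,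
and rotating the circle so that `q` goes to `0`, amounts to rotating the `k` points by `s` steps and
then inserting them so that place `0` is free. -/
theorem finRotate_pow_succAbove {k : ℕ} (s : ℕ) (q : Fin (k + 1)) (hq : q.1 = k - s % k)
    (i : Fin k) :
    (finRotate (k + 1) ^ (k + 1 - q.1) : Equiv.Perm (Fin (k + 1))) (q.succAbove i) =
      ((finRotate k ^ s : Equiv.Perm (Fin k)) i).succ := by
  apply Fin.ext
  rw [val_finRotate_pow, Fin.val_succ, val_finRotate_pow]
  have hi := i.2
  have hs : s % k < k := Nat.mod_lt _ (by omega)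
  rw [Nat.add_mod i.1 s k, Nat.mod_eq_of_lt hi]
  generalize s % k = t at *
  by_cases h : i.1 < q.1
  · rw [Fin.succAbove_of_castSucc_lt _ _ h, Fin.val_castSucc,
      Nat.mod_eq_of_lt (by omega), Nat.mod_eq_of_lt (by omega)]
    omega
  · rw [Fin.succAbove_of_le_castSucc _ _ (by simpa [Fin.le_def] using h), Fin.val_succ,
      Nat.mod_eq_sub_mod (by omega), Nat.mod_eq_of_lt (by omega), Nat.mod_eq_sub_mod (by omega),
      Nat.mod_eq_of_lt (by omega)]
    omega

open PartialPerm

/-- A map of rank `k < |Y|` with `k + 2 ≤ n` is a product of two maps of rank `k + 1`. -/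
theorem exists_mul_of_rank_lt {n : ℕ} {Y : Finset (Fin n)} {α : PartialPerm n}
    (hα : α ∈ POPIRange Y)
    (h1 : α.rank < Y.card) (h2 : α.rank + 2 ≤ n) :
    ∃ β ∈ POPIRange Y, ∃ γ ∈ POPIRange Y, β.rank = α.rank + 1 ∧ γ.rank = α.rank + 1 ∧
      α = β * γ := by
  have hcard := card_dom α
  have him : α.im.card = α.rank := rfl
  generalize α.rank = k at *
  obtain ⟨x, hx⟩ : ∃ x, x ∉ α.dom := by
    by_contra! h
    have : α.dom = Finset.univ := Finset.eq_univ_of_forall h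
    rw [this, Finset.card_univ, Fintype.card_fin] at hcard
    omega
  obtain ⟨z, hzY, hz⟩ := Finset.exists_mem_notMem_of_card_lt_card (him.trans_lt h1)
  obtain ⟨U, hUY, hU⟩ := Finset.exists_subset_card_eq (show k + 1 ≤ Y.card from h1)
  obtain ⟨v, hv⟩ : ∃ v, v ∉ U := by
    by_contra! h
    have : U = Finset.univ := Finset.eq_univ_of_forall h
    rw [this, Finset.card_univ, Fintype.card_fin] at hU
    omega
  -- enumerate the enlarged domain and image cyclically, starting with the new points
  obtain ⟨c, hc, hcr, hc0⟩ := exists_cycHom_enum_at (insert x α.dom)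
    (by rw [Finset.card_insert_of_notMem hx, hcard]) 0 (Finset.mem_insert_self _ _)
  obtain ⟨d, hd, hdr, hd0⟩ := exists_cycHom_enum_at (insert z α.im)
    (by rw [Finset.card_insert_of_notMem hz, him]) 0 (Finset.mem_insert_self _ _)
  have hsucc : CycHom (Fin.succEmb k) := (Fin.strictMono_succ).cycHom
  have tail : ∀ (e : Fin (k + 1) ↪ Fin n) (X : Finset (Fin n)) (x : Fin n), x ∉ X →
      (∀ a, a ∈ insert x X ↔ ∃ i, e i = a) → e 0 = x →
      ∀ a, a ∈ X ↔ ∃ i, ((Fin.succEmb k).trans e) i = a := by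
    intro e X x hx her he0 a
    constructor
    · intro ha
      obtain ⟨i, hi⟩ := (her a).1 (Finset.mem_insert_of_mem ha)
      obtain rfl | ⟨j, rfl⟩ := i.eq_zero_or_eq_succ
      · exact (hx (by rwa [← he0, hi])).elim
      · exact ⟨j, hi⟩
    · rintro ⟨i, hi⟩
      refine Finset.mem_of_mem_insert_of_ne ((her a).2 ⟨_, hi⟩) ?_
      rintro rfl
      exact Fin.succ_ne_zero _ (e.injective (hi.trans he0.symm))
  -- in these enumerations without the new points, `α` is a rotation by `s + 1` steps
  obtain ⟨δ, hδ, hαδ⟩ := OrientationPreserving.exists_eq_ofSeq hα.1 (hsucc.trans hc)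
    (tail c _ _ hx hcr hc0)
  obtain ⟨s, hs⟩ := CycHom.eq_comp_finRotate_pow (hsucc.trans hd) hδ (fun i =>
    (tail d _ _ hz hdr hd0 _).1 (by rw [hαδ, mem_im_ofSeq]; exact ⟨i, rfl⟩))
  -- `f` enumerates the `k + 2` intermediate points: `f 0` is in the gap of `x`, and `f q.succ = v`,
  -- the only one that may be outside `Y`, is in the gap of `z`
  obtain ⟨q, hq⟩ : ∃ q : Fin (k + 1), q.1 = k - (s + 1) % k := ⟨⟨k - (s + 1) % k, by omega⟩, rfl⟩
  obtain ⟨f, hf, hfr, hfq⟩ := exists_cycHom_enum_at (insert v U)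
    (by rw [Finset.card_insert_of_notMem hv, hU]) q.succ (Finset.mem_insert_self _ _)
  set ρ := (finRotate (k + 1) ^ (k + 1 - q.1) : Equiv.Perm (Fin (k + 1)))
  refine ⟨ofSeq c ((Fin.succAboveEmb q.succ).trans f),
    ⟨orientationPreserving_ofSeq hc (hf.comp (Fin.strictMono_succAbove _).cycHom), ?_⟩,
    ofSeq ((Fin.succEmb _).trans f) (ρ.toEmbedding.trans d),
    ⟨orientationPreserving_ofSeq (hf.comp (Fin.strictMono_succ).cycHom)
      (hd.comp (cycHom_finRotate_pow _ _)), ?_⟩, rank_ofSeq _ _, rank_ofSeq _ _, ?_⟩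
  · intro y hy
    obtain ⟨i, rfl⟩ := (mem_im_ofSeq _ _ _).1 hy
    refine hUY (Finset.mem_of_mem_insert_of_ne ((hfr _).2 ⟨_, rfl⟩) ?_)
    rw [← hfq]
    exact fun h => Fin.succAbove_ne _ _ (f.injective h)
  · intro y hy
    obtain ⟨i, rfl⟩ := (mem_im_ofSeq _ _ _).1 hy
    exact Finset.insert_subset hzY hα.2 ((hdr _).2 ⟨_, rfl⟩)
  · refine ext_some fun a b => ?_
    rw [hαδ, mul_eq_some]
    simp only [ofSeq_eq_some]
    constructor
    · rintro ⟨i, rfl, rfl⟩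
      refine ⟨_, ⟨i.succ, rfl, rfl⟩, q.succAbove i, ?_, ?_⟩
      · exact congrArg f (Fin.succ_succAbove_succ _ _).symm
      · rw [hs]
        exact congrArg d (finRotate_pow_succAbove (s + 1) q hq i)
    · rintro ⟨_, ⟨i, rfl, rfl⟩, j, hj, rfl⟩
      have hj : j.succ = q.succ.succAbove i := f.injective hj
      obtain rfl | ⟨i, rfl⟩ := i.eq_zero_or_eq_succ
      · rw [Fin.succ_succAbove_zero] at hj
        exact (Fin.succ_ne_zero _ hj).elim
      · rw [Fin.succ_succAbove_succ] at hj
        obtain rfl := Fin.succ_injective _ hj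
        refine ⟨i, rfl, ?_⟩
        rw [hs]
        exact (congrArg d (finRotate_pow_succAbove (s + 1) q hq i)).symm

/-! ### Domains, images and powers of the cyclic shift -/

namespace PartialPerm

variable {n : ℕ} {Y : Finset (Fin n)}

theorem rank_le_of_mem_POPIRange {α : PartialPerm n} (hα : α ∈ POPIRange Y) :
    α.rank ≤ Y.card :=
  Finset.card_le_card hα.2

theorem im_eq_of_mem_POPIRange {α : PartialPerm n} (hα : α ∈ POPIRange Y)
    (h : α.rank = Y.card) : α.im = Y :=
  Finset.eq_of_subset_of_card_le hα.2 h.ge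

theorem dom_mul_subset (α β : PartialPerm n) : (α * β).dom ⊆ α.dom := by
  intro x hx
  obtain ⟨y, hy⟩ := (mem_dom _ _).1 hx
  obtain ⟨z, hz, _⟩ := (mul_eq_some _ _ _ _).1 hy
  exact (mem_dom _ _).2 ⟨z, hz⟩

/-- The domain of a product is contained in the domain of its first factor. -/
theorem exists_dom_subset_of_mem_closure {A : Set (PartialPerm n)} {α : PartialPerm n}
    (hα : α ∈ Subsemigroup.closure A) : ∃ a ∈ A, α.dom ⊆ a.dom := by
  induction hα using Subsemigroup.closure_induction with
  | mem x hx => exact ⟨x, hx, Finset.Subset.refl _⟩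
  | mul x y _ _ ihx _ =>
    obtain ⟨a, ha, h⟩ := ihx
    exact ⟨a, ha, (dom_mul_subset x y).trans h⟩

theorem dom_cyclicShiftFun (Y : Finset (Fin n)) : (cyclicShiftFun Y).dom = Y := by
  ext x
  rw [mem_dom, cyclicShiftFun_apply]
  by_cases h : x ∈ Y <;> simp [h]

theorem rank_cyclicShiftFun (Y : Finset (Fin n)) : (cyclicShiftFun Y).rank = Y.card := by
  rw [← card_dom, dom_cyclicShiftFun]

theorem cyclicShiftFun_orderEmb (Y : Finset (Fin n)) (i : Fin Y.card) :
    cyclicShiftFun Y (Y.orderEmbOfFin rfl i) = some (Y.orderEmbOfFin rfl (finRotate _ i)) := by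
  rw [cyclicShiftFun_apply, dif_pos (Finset.orderEmbOfFin_mem Y rfl i)]
  have : (⟨Y.orderEmbOfFin rfl i, Finset.orderEmbOfFin_mem Y rfl i⟩ : Y) =
      Y.orderIsoOfFin rfl i := Subtype.ext (Finset.coe_orderIsoOfFin_apply Y rfl i).symm
  rw [this, ← Finset.coe_orderIsoOfFin_apply]
  simp [cyclicShiftPerm, Equiv.permCongr_apply]

theorem cyclicShiftFun_pow_orderEmb (Y : Finset (Fin n)) (s : ℕ) (i : Fin Y.card) :
    (cyclicShiftFun Y ^ s) (Y.orderEmbOfFin rfl i) =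
      some (Y.orderEmbOfFin rfl ((finRotate _ ^ s : Equiv.Perm (Fin Y.card)) i)) := by
  induction s with
  | zero => rfl
  | succ s ih =>
    rw [pow_succ, mul_eq_some]
    refine ⟨_, ih, ?_⟩
    rw [cyclicShiftFun_orderEmb, pow_succ', Equiv.Perm.mul_apply]

theorem pow_succ_mem_of_mem {M : Type*} [Monoid M] {T : Subsemigroup M} {g : M} (hg : g ∈ T)
    (s : ℕ) : g ^ (s + 1) ∈ T := by
  induction s with
  | zero => simpa using hg
  | succ s ih => rw [pow_succ]; exact mul_mem ih hg

/-- Two maps onto `Y` with the same domain differ by a rotation of `Y`. The exponent is positive, so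
that the power of the cyclic shift lies in the semigroup it generates. -/
theorem exists_eq_mul_cyclicShiftFun_pow {α β : PartialPerm n} (hα : α ∈ POPIRange Y)
    (hβ : β ∈ POPIRange Y) (hα' : α.rank = Y.card) (hdom : α.dom = β.dom) :
    ∃ s, α = β * cyclicShiftFun Y ^ (s + 1) := by
  have hβ' : β.rank = Y.card := by rw [← card_dom, ← hdom, card_dom, hα']
  obtain ⟨c, hc, hcr⟩ := exists_cycHom_enum α.dom ((card_dom α).trans hα')
  obtain ⟨a, ha, hαa⟩ := OrientationPreserving.exists_eq_ofSeq hα.1 hc hcr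
  obtain ⟨b, hb, hβb⟩ := OrientationPreserving.exists_eq_ofSeq hβ.1 hc (by rwa [← hdom])
  have hbY : ∀ y, y ∈ Y ↔ ∃ i, b i = y := fun y => by
    rw [← mem_im_ofSeq c b, ← hβb, im_eq_of_mem_POPIRange hβ hβ']
  obtain ⟨s, hs⟩ := hb.eq_comp_finRotate_pow ha fun i =>
    (hbY _).1 (hα.2 (by rw [hαa, mem_im_ofSeq]; exact ⟨i, rfl⟩))
  obtain ⟨t, ht⟩ := CycHom.eq_comp_finRotate_pow (c := (Y.orderEmbOfFin rfl).toEmbedding)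
    (Y.orderEmbOfFin rfl).strictMono.cycHom hb fun i => by
      have := (Set.ext_iff.1 (Finset.range_orderEmbOfFin Y rfl) (b i)).2 ((hbY _).2 ⟨i, rfl⟩)
      exact this
  have hg : ∀ i, (cyclicShiftFun Y ^ (s + 1)) (b i) = some (a i) := fun i => by
    rw [hs, ht i, ht]
    refine (cyclicShiftFun_pow_orderEmb Y (s + 1) _).trans ?_
    rw [← Equiv.Perm.mul_apply, ← Equiv.Perm.mul_apply, ← pow_add, ← pow_add, add_comm]
    rfl
  refine ⟨s, ext_some fun x y => ?_⟩
  rw [mul_eq_some, hαa, hβb]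
  simp only [ofSeq_eq_some]
  constructor
  · rintro ⟨i, rfl, rfl⟩
    exact ⟨_, ⟨i, rfl, rfl⟩, hg i⟩
  · rintro ⟨_, ⟨i, rfl, rfl⟩, h⟩
    exact ⟨i, rfl, Option.some_injective _ ((hg i).symm.trans h)⟩

/-! ### Generating sets -/

/-- The maps that are not products of maps of larger rank generate: those of rank `|Y|` and, if
`Y` is the whole chain, those of rank `n - 1`. -/
theorem POPIRange_le_of_large_rank {T : Subsemigroup (PartialPerm n)}
    (h : ∀ α ∈ POPIRange Y, α.rank = Y.card ∨ n < α.rank + 2 → α ∈ T) : POPIRange Y ≤ T := by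
  have key : ∀ m, ∀ α ∈ POPIRange Y, Y.card ≤ α.rank + m → α ∈ T := by
    intro m
    induction m with
    | zero => exact fun α hα hm => h α hα (Or.inl (le_antisymm (rank_le_of_mem_POPIRange hα) hm))
    | succ m ih =>
      intro α hα hm
      by_cases hc : α.rank = Y.card ∨ n < α.rank + 2
      · exact h α hα hc
      · have := rank_le_of_mem_POPIRange hα
        obtain ⟨β, hβ, γ, hγ, h1, h2, rfl⟩ := exists_mul_of_rank_lt hα (by omega) (by omega)
        exact mul_mem (ih β hβ (by omega)) (ih γ hγ (by omega))
  exact fun α hα => key Y.card α hα (by omega)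

theorem POPIRange_le_of_rank_eq {T : Subsemigroup (PartialPerm n)} (hY : Y.card < n)
    (h : ∀ α ∈ POPIRange Y, α.rank = Y.card → α ∈ T) : POPIRange Y ≤ T :=
  POPIRange_le_of_large_rank fun α hα hr => h α hα (by
    have := rank_le_of_mem_POPIRange hα
    omega)

/-- The cyclic shift of `Y` and one map for each possible domain of size `|Y|` generate. -/
theorem POPIRange_le_of_transversal {T : Subsemigroup (PartialPerm n)} (hY : Y.card < n)
    (hg : cyclicShiftFun Y ∈ T)
    (h : ∀ X : Finset (Fin n), X.card = Y.card → ∃ β ∈ POPIRange Y, β ∈ T ∧ β.dom = X) :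
    POPIRange Y ≤ T := by
  refine POPIRange_le_of_rank_eq hY fun α hα hr => ?_
  obtain ⟨β, hβ, hβT, hdom⟩ := h α.dom ((card_dom α).trans hr)
  obtain ⟨s, rfl⟩ := exists_eq_mul_cyclicShiftFun_pow hα hβ hr hdom.symm
  exact mul_mem hβT (pow_succ_mem_of_mem hg s)

theorem exists_mem_POPIRange_dom_eq {X : Finset (Fin n)} (hX : X.card = Y.card) :
    ∃ α ∈ POPIRange Y, α.dom = X := by
  obtain ⟨c, hc, hcX⟩ := exists_cycHom_enum X hX
  obtain ⟨d, hd, hdY⟩ := exists_cycHom_enum Y rfl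
  refine ⟨ofSeq c d, ⟨orientationPreserving_ofSeq hc hd, fun y hy => ?_⟩, ?_⟩
  · rwa [hdY, ← mem_im_ofSeq c d]
  · ext x
    rw [mem_dom_ofSeq, hcX]

theorem mem_POPIRange_univ {α : PartialPerm n} :
    α ∈ POPIRange (Finset.univ : Finset (Fin n)) ↔ α.OrientationPreserving :=
  ⟨fun h => h.1, fun h => ⟨h, Finset.subset_univ _⟩⟩

/-- The rotations act transitively on the chain. -/
theorem exists_rotation (p x : Fin n) :
    ∃ ρ : Equiv.Perm (Fin n), ρ p = x ∧ CycHom ρ ∧ CycHom ρ.symm := by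
  obtain ⟨s, hs⟩ := exists_finRotate_pow_eq p x
  refine ⟨finRotate n ^ (s + 1), hs, cycHom_finRotate_pow _ _, fun i j k h => ?_⟩
  refine (cycHom_finRotate_pow n (s + 1)).reflect ?_
  simpa only [Equiv.apply_symm_apply] using h

theorem orientationPreserving_toPEquiv {ρ : Equiv.Perm (Fin n)} (hρ : CycHom ρ) :
    OrientationPreserving (n := n) ρ.toPEquiv := by
  rw [orientationPreserving_iff]
  simp only [Equiv.toPEquiv_apply, Option.some.injEq]
  rintro a b c _ _ _ rfl rfl rfl h1 h2
  exact hρ _ _ _ (Or.inl ⟨h1, h2⟩)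

/-- Every orientation-preserving permutation of the chain is a power of the cyclic shift. -/
theorem mem_of_rank_eq {T : Subsemigroup (PartialPerm n)} (hg : cyclicShiftFun Finset.univ ∈ T)
    {α : PartialPerm n} (hα : α.OrientationPreserving) (hr : α.rank = n) : α ∈ T := by
  have hcard : (Finset.univ : Finset (Fin n)).card = n := by simp
  have hd : α.dom = Finset.univ :=
    Finset.eq_univ_of_card _ (by rw [card_dom, hr, Fintype.card_fin])
  obtain ⟨s, rfl⟩ := exists_eq_mul_cyclicShiftFun_pow (mem_POPIRange_univ.2 hα)
    (cyclicShiftFun_mem _) (hr.trans hcard.symm) (by rw [hd, dom_cyclicShiftFun])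
  exact mul_mem hg (pow_succ_mem_of_mem hg s)

theorem rank_toPEquiv (ρ : Equiv.Perm (Fin n)) : rank (n := n) ρ.toPEquiv = n := by
  have : im (n := n) ρ.toPEquiv = Finset.univ :=
    Finset.eq_univ_of_forall fun y => (mem_im _ _).2 ⟨ρ.symm y, by simp [Equiv.toPEquiv_apply]⟩
  rw [rank, this, Finset.card_univ, Fintype.card_fin]

/-- The cyclic shift of the chain and that of the chain without a point `p` generate everything. -/
theorem POPIRange_univ_le {T : Subsemigroup (PartialPerm n)} (p : Fin n)
    (hg : cyclicShiftFun Finset.univ ∈ T) (he : cyclicShiftFun (Finset.univ.erase p) ∈ T) :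
    POPIRange (Finset.univ : Finset (Fin n)) ≤ T := by
  have hcard : (Finset.univ : Finset (Fin n)).card = n := by simp
  refine POPIRange_le_of_large_rank fun α hα hr => ?_
  rw [hcard] at hr
  have hle := rank_le_of_mem_POPIRange hα
  rw [hcard] at hle
  by_cases hn : α.rank = n
  · exact mem_of_rank_eq hg hα.1 hn
  have hlt : α.rank < (Finset.univ : Finset (Fin n)).card := by omega
  obtain ⟨x, -, hx⟩ := Finset.exists_mem_notMem_of_card_lt_card ((card_dom α).trans_lt hlt)
  obtain ⟨z, -, hz⟩ := Finset.exists_mem_notMem_of_card_lt_card (s := α.im) hlt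
  have hdom : ∀ y, y ∈ α.dom ↔ y ≠ x := by
    have : α.dom = Finset.univ.erase x := by
      refine Finset.eq_of_subset_of_card_le (fun y hy => ?_) ?_
      · exact Finset.mem_erase.2 ⟨fun h => hx (h ▸ hy), Finset.mem_univ _⟩
      · rw [Finset.card_erase_of_mem (Finset.mem_univ x), hcard, card_dom]
        omega
    simp [this]
  -- rotations move the missing points of domain and image to `p`
  obtain ⟨ρ, hρ, hρ1, hρ2⟩ := exists_rotation p x
  obtain ⟨τ, hτ, hτ1, hτ2⟩ := exists_rotation z p
  have hperm : ∀ {π : Equiv.Perm (Fin n)}, CycHom π → (π.toPEquiv : PartialPerm n) ∈ T :=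
    fun hπ => mem_of_rank_eq hg (orientationPreserving_toPEquiv hπ) (rank_toPEquiv _)
  obtain ⟨β, hβ⟩ : ∃ β : PartialPerm n, β = ρ.toPEquiv * α * τ.toPEquiv := ⟨_, rfl⟩
  have hβ' : ∀ a b, β a = some b ↔ α (ρ a) = some (τ.symm b) := by
    intro a b
    rw [hβ, mul_eq_some]
    simp only [mul_eq_some, Equiv.toPEquiv_apply, Option.some.injEq]
    constructor
    · rintro ⟨c, ⟨_, rfl, h⟩, rfl⟩
      rwa [Equiv.symm_apply_apply]
    · exact fun h => ⟨_, ⟨_, rfl, h⟩, Equiv.apply_symm_apply _ _⟩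
  have hαβ : α = ρ.symm.toPEquiv * β * τ.symm.toPEquiv := by
    refine ext_some fun a b => ?_
    rw [mul_eq_some]
    simp only [mul_eq_some, Equiv.toPEquiv_apply, Option.some.injEq]
    constructor
    · refine fun h => ⟨τ b, ⟨_, rfl, (hβ' _ _).2 ?_⟩, Equiv.symm_apply_apply _ _⟩
      simpa using h
    · rintro ⟨c, ⟨_, rfl, h⟩, rfl⟩
      simpa using (hβ' _ _).1 h
  have hβdom : β.dom = Finset.univ.erase p := by
    ext a
    rw [Finset.mem_erase, and_iff_left (Finset.mem_univ _), ← ρ.injective.ne_iff, hρ, ← hdom,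
      mem_dom, mem_dom]
    simp only [hβ']
    exact ⟨fun ⟨y, hy⟩ => ⟨_, hy⟩, fun ⟨y, hy⟩ => ⟨τ y, by simpa using hy⟩⟩
  have hβmem : β ∈ POPIRange (Finset.univ.erase p) := by
    refine ⟨?_, fun b hb => Finset.mem_erase.2 ⟨?_, Finset.mem_univ _⟩⟩
    · rw [hβ]
      exact ((orientationPreserving_toPEquiv hρ1).mul hα.1).mul (orientationPreserving_toPEquiv hτ1)
    · rintro rfl
      obtain ⟨a, ha⟩ := (mem_im _ _).1 hb
      refine hz ((mem_im _ _).2 ⟨ρ a, ?_⟩)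
      rw [(hβ' _ _).1 ha, ← hτ, Equiv.symm_apply_apply]
  obtain ⟨s, hs⟩ := exists_eq_mul_cyclicShiftFun_pow hβmem (cyclicShiftFun_mem _)
    (by rw [← card_dom, hβdom]) (by rw [hβdom, dom_cyclicShiftFun])
  rw [hαβ, hs]
  exact mul_mem (mul_mem (hperm hρ2) (mul_mem he (pow_succ_mem_of_mem he s))) (hperm hτ2)

end PartialPerm

/-! ### The rank of the semigroup -/

/-- Generation of a subsemigroup `S` of `M` can be tested in `M`. -/
theorem Subsemigroup.closure_eq_top_of_le_closure_image {M : Type*} [Semigroup M] {S : Subsemigroup M}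
    {A : Set S} (h : S ≤ Subsemigroup.closure (Subtype.val '' A)) :
    Subsemigroup.closure A = ⊤ := by
  refine eq_top_iff.2 fun x _ => ?_
  have hx := h x.2
  have e : Subsemigroup.closure (Subtype.val '' A) =
      (Subsemigroup.closure A).map (MulMemClass.subtype S) :=
    (MulHom.map_mclosure (MulMemClass.subtype S) A).symm
  rw [e] at hx
  obtain ⟨y, hy, hyx⟩ := hx
  rwa [← Subtype.ext hyx]

theorem exists_dom_subset_of_closure_eq_top {n : ℕ} {Y : Finset (Fin n)} {A : Set (POPIRange Y)}
    (hA : Subsemigroup.closure A = ⊤) (α : POPIRange Y) :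
    ∃ a ∈ A, (α : PartialPerm n).dom ⊆ (a : PartialPerm n).dom := by
  have hα : α ∈ Subsemigroup.closure A := hA ▸ Subsemigroup.mem_top α
  have : (α : PartialPerm n) ∈ Subsemigroup.closure (Subtype.val '' A) := by
    have := Subsemigroup.mem_map_of_mem (MulMemClass.subtype (POPIRange Y)) hα
    rwa [MulHom.map_mclosure] at this
  obtain ⟨_, ⟨a, ha, rfl⟩, h⟩ := exists_dom_subset_of_mem_closure this
  exact ⟨a, ha, h⟩

theorem GreenR.dom_eq {n : ℕ} {Y : Finset (Fin n)} {α β : POPIRange Y} (h : GreenR α β) :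
    (α : PartialPerm n).dom = (β : PartialPerm n).dom := by
  have key : ∀ {α β : POPIRange Y}, GreenR α β →
      (α : PartialPerm n).dom ⊆ (β : PartialPerm n).dom := by
    intro α β h
    have hα : α ∈ principalRightIdeal β := h ▸ Or.inl rfl
    rcases hα with rfl | ⟨s, rfl⟩
    · exact Finset.Subset.refl _
    · exact dom_mul_subset _ _
  exact (key h).antisymm (key h.symm)

theorem semigroupRank_eq {S : Type*} [Semigroup S] (A : Finset S)
    (hA : Subsemigroup.closure (A : Set S) = ⊤)
    (h : ∀ B : Finset S, Subsemigroup.closure (B : Set S) = ⊤ → A.card ≤ B.card) :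
    semigroupRank S = A.card := by
  refine le_antisymm (Nat.sInf_le ⟨A, rfl, hA⟩) (le_csInf ⟨_, A, rfl, hA⟩ ?_)
  rintro _ ⟨B, rfl, hB⟩
  exact h B hB

/-- A smallest generating set has exactly one element of each possible domain of size `|Y|`, the one
with domain `Y` being the cyclic shift. -/
theorem semigroupRank_POPIRange_of_card_lt {n : ℕ} {Y : Finset (Fin n)} (hY : Y.card < n) :
    semigroupRank (POPIRange Y) = n.choose Y.card := by
  classical
  have hF : ∀ X : Finset (Fin n), ∃ α : POPIRange Y, (X = Y → α = cyclicShift Y) ∧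
      (X.card = Y.card → (α : PartialPerm n).dom = X) := by
    intro X
    by_cases hX : X = Y
    · exact ⟨cyclicShift Y, fun _ => rfl, fun _ => (dom_cyclicShiftFun Y).trans hX.symm⟩
    · by_cases hc : X.card = Y.card
      · obtain ⟨α, hα, h⟩ := exists_mem_POPIRange_dom_eq hc
        exact ⟨⟨α, hα⟩, fun h => (hX h).elim, fun _ => h⟩
      · exact ⟨cyclicShift Y, fun _ => rfl, fun h => (hc h).elim⟩
  choose F hFY hFd using hF
  have hP : (Finset.powersetCard Y.card (Finset.univ : Finset (Fin n))).card =
      n.choose Y.card := by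
    rw [Finset.card_powersetCard, Finset.card_univ, Fintype.card_fin]
  have hmem : ∀ X : Finset (Fin n),
      X ∈ Finset.powersetCard Y.card Finset.univ ↔ X.card = Y.card := fun X => by
    simp [Finset.mem_powersetCard]
  have hA : ((Finset.powersetCard Y.card Finset.univ).image F).card = n.choose Y.card := by
    rw [Finset.card_image_of_injOn, hP]
    intro X hX X' hX' h
    rw [← hFd X ((hmem _).1 hX), h, hFd X' ((hmem _).1 hX')]
  rw [← hA]
  refine semigroupRank_eq _ ?_ fun B hB => ?_
  · refine Subsemigroup.closure_eq_top_of_le_closure_image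
      (POPIRange_le_of_transversal hY ?_ fun X hX => ?_)
    · exact Subsemigroup.subset_closure
        ⟨F Y, Finset.mem_image_of_mem F ((hmem _).2 rfl), by rw [hFY Y rfl]; rfl⟩
    · exact ⟨F X, (F X).2, Subsemigroup.subset_closure
        ⟨F X, Finset.mem_image_of_mem F ((hmem _).2 hX), rfl⟩, hFd X hX⟩
  · rw [hA, ← hP]
    refine (Finset.card_le_card fun X hX => ?_).trans
      (Finset.card_image_le (s := B) (f := fun a => (a : PartialPerm n).dom))
    obtain ⟨a, ha, h⟩ := exists_dom_subset_of_closure_eq_top hB (F X)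
    rw [hFd X ((hmem _).1 hX)] at h
    refine Finset.mem_image.2 ⟨a, ha, (Finset.eq_of_subset_of_card_le h ?_).symm⟩
    rw [card_dom, (hmem _).1 hX]
    exact rank_le_of_mem_POPIRange a.2

theorem semigroupRank_POPIRange_univ {n : ℕ} (p : Fin n) :
    semigroupRank (POPIRange (Finset.univ : Finset (Fin n))) = 2 := by
  classical
  obtain ⟨e, he⟩ : ∃ e : POPIRange (Finset.univ : Finset (Fin n)),
      (e : PartialPerm n) = cyclicShiftFun (Finset.univ.erase p) :=
    ⟨⟨_, mem_POPIRange_univ.2 (cyclicShiftFun_mem _).1⟩, rfl⟩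
  have hne : cyclicShift Finset.univ ≠ e := by
    intro h
    have h1 := dom_cyclicShiftFun (Finset.univ : Finset (Fin n))
    have h2 := dom_cyclicShiftFun (Finset.univ.erase p)
    rw [← he, ← h] at h2
    exact Finset.notMem_erase p _ (h2 ▸ h1 ▸ Finset.mem_univ p)
  rw [← Finset.card_pair hne]
  refine semigroupRank_eq _ ?_ fun B hB => ?_
  · refine Subsemigroup.closure_eq_top_of_le_closure_image (POPIRange_univ_le p ?_ ?_)
    · exact Subsemigroup.subset_closure ⟨cyclicShift Finset.univ, by simp, rfl⟩
    · exact Subsemigroup.subset_closure ⟨e, by simp, he⟩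
  · rw [Finset.card_pair hne]
    -- one generator has full domain, as the units are products of such
    obtain ⟨a, ha, h1⟩ := exists_dom_subset_of_closure_eq_top hB (cyclicShift Finset.univ)
    have h1 : Finset.univ ⊆ (a : PartialPerm n).dom := by
      rwa [cyclicShift, dom_cyclicShiftFun] at h1
    -- and not all of them do, as maps with full domain are closed under products
    obtain ⟨b, hb, h2⟩ : ∃ b ∈ B, (b : PartialPerm n).dom ≠ Finset.univ := by
      by_contra! hall
      have key : ∀ x ∈ Subsemigroup.closure (B : Set (POPIRange (Finset.univ : Finset (Fin n)))),
          (x : PartialPerm n).dom = Finset.univ := by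
        intro x hx
        induction hx using Subsemigroup.closure_induction with
        | mem x hx => exact hall x hx
        | mul x y _ _ ihx ihy =>
          refine Finset.eq_univ_of_forall fun i => (mem_dom _ _).2 ?_
          obtain ⟨j, hj⟩ := (mem_dom _ _).1 (ihx ▸ Finset.mem_univ i)
          obtain ⟨l, hl⟩ := (mem_dom _ _).1 (ihy ▸ Finset.mem_univ j)
          exact ⟨l, (mul_eq_some _ _ _ _).2 ⟨j, hj, hl⟩⟩
      have := key e (hB ▸ Subsemigroup.mem_top e)
      rw [he, dom_cyclicShiftFun] at this
      exact Finset.notMem_erase p _ (this ▸ Finset.mem_univ p)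
    refine Finset.one_lt_card.2 ⟨a, ha, b, hb, ?_⟩
    rintro rfl
    exact h2 (Finset.univ_subset_iff.1 h1)

theorem mainTheorem1 (n : ℕ) (Y : Finset (Fin n)) (hY : Y.Nonempty) :
    (Y.card < n → semigroupRank (POPIRange Y) = n.choose Y.card) ∧
    (Y.card = n → semigroupRank (POPIRange Y) = 2) ∧
    (Y.card < n →
      Subsemigroup.closure {α : POPIRange Y | (α : PartialPerm n).rank = Y.card} = ⊤ ∧
      ∀ A : Set (POPIRange Y), cyclicShift Y ∈ A →
        (∀ α : POPIRange Y, (α : PartialPerm n).rank = Y.card → ∃ β ∈ A, GreenR α β) →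
        Subsemigroup.closure A = ⊤) := by
  refine ⟨semigroupRank_POPIRange_of_card_lt, fun h => ?_, fun h => ⟨?_, fun A hg hA => ?_⟩⟩
  · obtain rfl : Y = Finset.univ := Finset.eq_univ_of_card _ (by rw [h, Fintype.card_fin])
    exact semigroupRank_POPIRange_univ hY.choose
  · exact Subsemigroup.closure_eq_top_of_le_closure_image (POPIRange_le_of_rank_eq h fun α hα hr =>
      Subsemigroup.subset_closure ⟨⟨α, hα⟩, hr, rfl⟩)
  · refine Subsemigroup.closure_eq_top_of_le_closure_image (POPIRange_le_of_transversal h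
      (Subsemigroup.subset_closure ⟨_, hg, rfl⟩) fun X hX => ?_)
    obtain ⟨α, hα, rfl⟩ := exists_mem_POPIRange_dom_eq hX
    obtain ⟨β, hβ, hR⟩ := hA ⟨α, hα⟩ ((card_dom α).symm.trans hX)
    exact ⟨β, β.2, Subsemigroup.subset_closure ⟨β, hβ, rfl⟩, hR.dom_eq.symm⟩
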